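/- A \emph{planar network} is a finite family of regular $C^2$ curves in $\mathbb{R}^2$, each of which is a compact arc with two endpoints, a non-compact curve with one endpoint, a complete non-compact curve without endpoints, or a closed curve without endpoints; curves are $C^2$ up to their endpoints, and non-compact ends go to infinity. It is \emph{embedded} if the curves do not meet each other or themselves except at endpoints. It is \emph{regular} if exactly three ends of curves meet at every endpoint (so there are no free endpoints) and the angles between the curves there are $\frac{2\pi}{3}$. A \emph{regular shrinker} is an embedded regular network such that $$\bar k + x^\perp = 0$$ at every point $x$ of every curve (including its endpoints), where $\bar k$ is the curvature vector of the curve at $x$ and $x^\perp$ is the component of the position vector $x$ normal to the curve. The \emph{closed regions} of a network are the bounded connected components of its complement in $\mathbb{R}^2$. For any regular shrinker with at least one closed region, let $F_i$ be its closed regions. Then $\bigcup_i \mathrm{cl}(F_i)$ is star-shaped with respect to the origin $O$; in particular $O \in \bigcup_i \mathrm{cl}(F_i)$. -/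

import Mathlib

noncomputable section

namespace PlaneNetwork

/-- The Euclidean plane. -/
abbrev Plane : Type := EuclideanSpace ℝ (Fin 2)

/-- The possible types of curves in a network without boundary points: compact arcs with two
endpoints, non-compact arcs with one endpoint, complete non-compact curves without endpoints,
and closed curves without endpoints. -/
inductive EdgeKind : Type
  | arc : EdgeKind
  | ray : EdgeKind
  | line : EdgeKind
  | loop : EdgeKind

/-- The parameter interval. A closed curve is a `1`-periodic curve, traversed once. -/
def EdgeKind.dom : EdgeKind → Set ℝ
  | .arc => Set.Icc 0 1
  | .ray => Set.Ici 0
  | .line => Set.univ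
  | .loop => Set.Ico 0 1

/-- The parameters of the endpoints of a curve. -/
def EdgeKind.endpoints : EdgeKind → Set ℝ
  | .arc => {0, 1}
  | .ray => {0}
  | .line => ∅
  | .loop => ∅

/-- A regular parametrized `C²` curve in the plane, whose non-compact ends go to infinity.
Only the restriction of `curve` to `kind.dom` is meaningful. For arcs and rays, being of class
`C²` up to the endpoints means having a `C²` extension to `ℝ`, and the derivatives of the
extension at the endpoints are the one-sided derivatives of the curve. -/
structure Edge where
  kind : EdgeKind
  curve : ℝ → Plane
  contDiff : ContDiff ℝ 2 curve
  regular : ∀ t ∈ kind.dom, deriv curve t ≠ 0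
  periodic : kind = EdgeKind.loop → Function.Periodic curve 1
  proper_atTop : kind = EdgeKind.ray ∨ kind = EdgeKind.line →
    Filter.Tendsto (fun t => ‖curve t‖) Filter.atTop Filter.atTop
  proper_atBot : kind = EdgeKind.line →
    Filter.Tendsto (fun t => ‖curve t‖) Filter.atBot Filter.atTop

namespace Edge

/-- The unit tangent vector. -/
def unitTangent (e : Edge) (t : ℝ) : Plane :=
  ‖deriv e.curve t‖⁻¹ • deriv e.curve t

/-- The component of the vector `v` normal to the curve at the parameter `t`. -/
def normalPart (e : Edge) (t : ℝ) (v : Plane) : Plane :=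
  v - (inner ℝ v (e.unitTangent t)) • e.unitTangent t

/-- The curvature vector (the second derivative with respect to arc length) in an arbitrary
regular parametrization: the normal part of `γ'' / |γ'|²`. -/
def curvatureVector (e : Edge) (t : ℝ) : Plane :=
  (‖deriv e.curve t‖ ^ 2)⁻¹ • e.normalPart t (deriv (deriv e.curve) t)

end Edge

end PlaneNetwork

open PlaneNetwork in
/-- An embedded planar network: a family of curves which are injective and pairwise disjoint
except that endpoints may coincide. -/
structure PlaneNetwork (ι : Type*) where
  edge : ι → Edge
  embedded : ∀ i j : ι, ∀ s ∈ (edge i).kind.dom, ∀ t ∈ (edge j).kind.dom,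
    (edge i).curve s = (edge j).curve t →
      (i = j ∧ s = t) ∨ (s ∈ (edge i).kind.endpoints ∧ t ∈ (edge j).kind.endpoints)

namespace PlaneNetwork

variable {ι : Type*}

/-- The set of points of the network. -/
def carrier (Γ : PlaneNetwork ι) : Set Plane :=
  ⋃ i, (Γ.edge i).curve '' (Γ.edge i).kind.dom

/-- The ends of the curves of the network, as pairs of a curve and an endpoint parameter. -/
def ends (Γ : PlaneNetwork ι) : Set (ι × ℝ) :=
  {e | e.2 ∈ (Γ.edge e.1).kind.endpoints}

/-- The point at which an end is located. -/
def endPoint (Γ : PlaneNetwork ι) (e : ι × ℝ) : Plane :=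
  (Γ.edge e.1).curve e.2

open Classical in
/-- The tangent direction at an end, pointing from the endpoint into the curve. -/
def endDirection (Γ : PlaneNetwork ι) (e : ι × ℝ) : Plane :=
  if e.2 = 0 then deriv (Γ.edge e.1).curve e.2 else -deriv (Γ.edge e.1).curve e.2

/-- The network has no free endpoints and satisfies the Herring condition: exactly three ends
meet at every endpoint, at angles `2π/3`. -/
structure IsRegular (Γ : PlaneNetwork ι) : Prop where
  degree : ∀ e ∈ Γ.ends, {f ∈ Γ.ends | Γ.endPoint f = Γ.endPoint e}.ncard = 3
  angle : ∀ e ∈ Γ.ends, ∀ f ∈ Γ.ends, e ≠ f → Γ.endPoint e = Γ.endPoint f →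
    InnerProductGeometry.angle (Γ.endDirection e) (Γ.endDirection f) = 2 * Real.pi / 3

/-- A regular shrinker: a regular network with `k + x^⊥ = 0` at every point of every curve. -/
structure IsRegularShrinker (Γ : PlaneNetwork ι) : Prop extends Γ.IsRegular where
  shrinker : ∀ i, ∀ t ∈ (Γ.edge i).kind.dom,
    (Γ.edge i).curvatureVector t + (Γ.edge i).normalPart t ((Γ.edge i).curve t) = 0

/-- The closed regions of the network: the bounded connected components of its complement. -/
def closedRegions (Γ : PlaneNetwork ι) : Set (Set Plane) :=
  {F | Bornology.IsBounded F ∧ ∃ x ∈ Γ.carrierᶜ, F = connectedComponentIn Γ.carrierᶜ x}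

end PlaneNetwork

end

/-!
Call an edge *radial* if it lies on a line through the origin. Along an edge the shrinker equation
has the first integral `k e^{-|x|²/2}` (`Edge.firstIntegral` is its square). Hence an edge is either
radial or everywhere transversal to the radial direction (`Edge.IsShrinking.angMom_eq_zero`), and
non-compact edges are radial, so that the network is conical at infinity
(`IsRegularShrinker.exists_cone`).

The heart of the matter is that a component `U` of the complement which is unbounded contains with
each point `y` the whole half-line `{l y : l ≥ 1}` (`smul_mem_of_not_isBounded`). For `y ∈ U`,
`y ≠ 0`, the condition that this half-line misses the network is open because the network is closed
and conical at infinity. The opposite condition is open too: let `p` be the first point of the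
network above `y`. It is not an interior point of a radial edge, since such an edge would continue
below `p`. If it is an interior point of a transversal edge, this edge meets all nearby radial
lines. If it is a vertex, the three unit directions of the edges at `p` have sum zero, so edges
leave `p` to both sides of its radial line, and together they meet all nearby radial lines
(`eventually_exists_smul_mem_carrier`). As `U \ {0}` is connected, the half-lines above its points
all meet the network or all miss it, and far out in an unbounded `U` they miss it.

Consequently, if `z` is in a closed region and `0 < μ ≤ 1`, then `μ z` cannot be in an unbounded
component; since the network has empty interior, `μ z` is in the closure of the union of the closed
regions. This closure is the union of the closures, since there are only finitely many closed
regions: each lies directly below some transversal edge, and an edge determines the region directly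
below it (`exists_isBelow`, `isBelow_iff`).
-/

open Set Filter Topology

noncomputable section

namespace PlaneNetwork

/-! ### The cross product and the angular momentum of a shrinking curve -/

/-- The signed area `a₀ b₁ - a₁ b₀` spanned by two vectors of the plane. -/
def cross (a b : Plane) : ℝ := a 0 * b 1 - a 1 * b 0

/-- The squared norm in coordinates. -/
def normSq (a : Plane) : ℝ := a 0 * a 0 + a 1 * a 1

theorem cross_self (a : Plane) : cross a a = 0 := by simp only [cross]; ring

theorem cross_swap (a b : Plane) : cross a b = -cross b a := by simp only [cross]; ring

theorem cross_smul_left (c : ℝ) (a b : Plane) : cross (c • a) b = c * cross a b := by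
  simp only [cross, PiLp.smul_apply, smul_eq_mul]; ring

theorem cross_smul_right (c : ℝ) (a b : Plane) : cross a (c • b) = c * cross a b := by
  simp only [cross, PiLp.smul_apply, smul_eq_mul]; ring

theorem cross_add_right (a b c : Plane) : cross a (b + c) = cross a b + cross a c := by
  simp only [cross, PiLp.add_apply]; ring

theorem cross_sub_right (a b c : Plane) : cross a (b - c) = cross a b - cross a c := by
  simp only [cross, PiLp.sub_apply]; ring

@[simp] theorem cross_zero_right (a : Plane) : cross a 0 = 0 := by simp [cross]

theorem inner_eq (a b : Plane) : inner ℝ a b = a 0 * b 0 + a 1 * b 1 := by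
  simp [PiLp.inner_apply, Fin.sum_univ_two, mul_comm]

theorem normSq_eq (a : Plane) : normSq a = ‖a‖ ^ 2 := by
  rw [← real_inner_self_eq_norm_sq, inner_eq, normSq]

theorem normSq_pos {a : Plane} (h : a ≠ 0) : 0 < normSq a := by
  rw [normSq_eq]; have := norm_pos_iff.2 h; positivity

@[fun_prop]
theorem continuous_cross {X : Type*} [TopologicalSpace X] {f g : X → Plane}
    (hf : Continuous f) (hg : Continuous g) : Continuous fun x => cross (f x) (g x) := by
  unfold cross; fun_prop

@[fun_prop]
theorem continuous_normSq {X : Type*} [TopologicalSpace X] {f : X → Plane}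
    (hf : Continuous f) : Continuous fun x => normSq (f x) := by
  unfold normSq; fun_prop

theorem hasDerivAt_apply {f : ℝ → Plane} {f' : Plane} {t : ℝ} (h : HasDerivAt f f' t)
    (i : Fin 2) : HasDerivAt (fun s => f s i) (f' i) t :=
  (EuclideanSpace.proj (𝕜 := ℝ) i : Plane →L[ℝ] ℝ).hasFDerivAt.comp_hasDerivAt t h

theorem hasDerivAt_cross {f g : ℝ → Plane} {f' g' : Plane} {t : ℝ} (hf : HasDerivAt f f' t)
    (hg : HasDerivAt g g' t) :
    HasDerivAt (fun s => cross (f s) (g s)) (cross f' (g t) + cross (f t) g') t := by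
  have := ((hasDerivAt_apply hf 0).mul (hasDerivAt_apply hg 1)).sub
    ((hasDerivAt_apply hf 1).mul (hasDerivAt_apply hg 0))
  refine this.congr_deriv ?_
  simp only [cross]; ring

theorem hasDerivAt_normSq {f : ℝ → Plane} {f' : Plane} {t : ℝ} (hf : HasDerivAt f f' t) :
    HasDerivAt (fun s => normSq (f s)) (2 * inner ℝ (f t) f') t := by
  have := ((hasDerivAt_apply hf 0).mul (hasDerivAt_apply hf 0)).add
    ((hasDerivAt_apply hf 1).mul (hasDerivAt_apply hf 1))
  refine this.congr_deriv ?_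
  rw [inner_eq]; ring

/-- A vector parallel to `q ≠ 0` is its own orthogonal projection to the line of `q`. -/
theorem eq_smul_of_cross_eq_zero {q x : Plane} (hq : q ≠ 0) (h : cross q x = 0) :
    x = (inner ℝ x q / normSq q) • q := by
  have hn := (normSq_pos hq).ne'
  have h' : q 0 * x 1 - q 1 * x 0 = 0 := h
  ext i
  rw [PiLp.smul_apply, smul_eq_mul, div_mul_eq_mul_div, eq_div_iff hn, inner_eq, normSq]
  fin_cases i
  · simp only [Fin.zero_eta]; linear_combination (-(q 1)) * h'
  · simp only [Fin.mk_one]; linear_combination (q 0) * h'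

theorem eq_of_hasDerivAt_zero {f : ℝ → ℝ} {S : Set ℝ} (hS : S.OrdConnected)
    (h : ∀ t ∈ S, HasDerivAt f 0 t) {s t : ℝ} (hs : s ∈ S) (ht : t ∈ S) : f s = f t := by
  have := hS.convex.norm_image_sub_le_of_norm_hasDerivWithin_le (C := 0)
    (fun x hx => (h x hx).hasDerivWithinAt) (by simp) hs ht
  rw [zero_mul, norm_le_zero_iff, sub_eq_zero] at this
  exact this.symm

theorem EdgeKind.ordConnected_dom (k : EdgeKind) : k.dom.OrdConnected := by
  cases k
  exacts [ordConnected_Icc, ordConnected_Ici, ordConnected_univ, ordConnected_Ico]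

namespace Edge

variable (e : Edge)

/-- The shrinker equation `k + x^⊥ = 0` along a curve. -/
def IsShrinking : Prop :=
  ∀ t ∈ e.kind.dom, e.curvatureVector t + e.normalPart t (e.curve t) = 0

/-- The angular momentum `γ × γ'`. It vanishes exactly where the curve is tangent to the radial
direction. -/
def angMom (t : ℝ) : ℝ := cross (e.curve t) (deriv e.curve t)

theorem continuous_curve : Continuous e.curve := e.contDiff.continuous

theorem hasDerivAt_curve (t : ℝ) : HasDerivAt e.curve (deriv e.curve t) t :=
  (e.contDiff.differentiable (by norm_num) t).hasDerivAt

theorem contDiff_deriv : ContDiff ℝ 1 (deriv e.curve) :=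
  (contDiff_succ_iff_deriv (n := 1)).1 (by simpa [one_add_one_eq_two] using e.contDiff) |>.2.2

theorem continuous_deriv : Continuous (deriv e.curve) := e.contDiff_deriv.continuous

theorem hasDerivAt_deriv (t : ℝ) :
    HasDerivAt (deriv e.curve) (deriv (deriv e.curve) t) t :=
  (e.contDiff_deriv.differentiable (by norm_num) t).hasDerivAt

variable {e}

/-- The shrinker equation in terms of `γ' × γ''`. -/
theorem IsShrinking.cross_deriv (he : e.IsShrinking) {t : ℝ} (ht : t ∈ e.kind.dom) :
    cross (deriv e.curve t) (deriv (deriv e.curve) t) =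
      normSq (deriv e.curve t) * e.angMom t := by
  have h := congrArg (cross (deriv e.curve t)) (he t ht)
  have hn : ‖deriv e.curve t‖ ≠ 0 := norm_ne_zero_iff.2 (e.regular t ht)
  simp only [curvatureVector, normalPart, unitTangent, cross_add_right, cross_smul_right,
    cross_sub_right, cross_self, cross_zero_right, mul_zero, sub_zero] at h
  rw [angMom, cross_swap (e.curve t), normSq_eq]
  field_simp at h
  linear_combination h

/-- The first integral of the shrinker equation: the square of `k e^{-|x|²/2}`. -/
def firstIntegral (e : Edge) (t : ℝ) : ℝ :=
  e.angMom t ^ 2 * Real.exp (-normSq (e.curve t)) / normSq (deriv e.curve t)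

theorem IsShrinking.firstIntegral_eq (he : e.IsShrinking) {s t : ℝ} (hs : s ∈ e.kind.dom)
    (ht : t ∈ e.kind.dom) : e.firstIntegral s = e.firstIntegral t := by
  refine eq_of_hasDerivAt_zero e.kind.ordConnected_dom (fun t ht => ?_) hs ht
  have hn := (normSq_pos (e.regular t ht)).ne'
  have h1 : HasDerivAt e.angMom _ t :=
    hasDerivAt_cross (e.hasDerivAt_curve t) (e.hasDerivAt_deriv t)
  have h2 := (hasDerivAt_normSq (e.hasDerivAt_curve t)).neg.exp
  have h3 := ((h1.pow 2).mul h2).div (hasDerivAt_normSq (e.hasDerivAt_deriv t)) hn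
  refine h3.congr_deriv ?_
  rw [div_eq_zero_iff]; left
  have key := he.cross_deriv ht
  have hid : cross (e.curve t) (deriv (deriv e.curve) t) * normSq (deriv e.curve t) =
      e.angMom t * inner ℝ (deriv e.curve t) (deriv (deriv e.curve) t) +
      inner ℝ (e.curve t) (deriv e.curve t) *
        cross (deriv e.curve t) (deriv (deriv e.curve) t) := by
    simp only [angMom, cross, normSq, inner_eq]; ring
  rw [key] at hid
  simp only [cross_self, zero_add, Pi.pow_apply, Pi.mul_apply, Pi.neg_apply]
  push_cast
  linear_combination 2 * e.angMom t * Real.exp (-normSq (e.curve t)) * hid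

/-- Either a shrinking curve is radial, or it is everywhere transversal to the radial direction. -/
theorem IsShrinking.angMom_eq_zero (he : e.IsShrinking) {s t : ℝ} (hs : s ∈ e.kind.dom)
    (ht : t ∈ e.kind.dom) (h : e.angMom s = 0) : e.angMom t = 0 := by
  have := he.firstIntegral_eq hs ht
  have hn := (normSq_pos (e.regular t ht)).ne'
  simp only [firstIntegral, h] at this
  have h0 : e.angMom t ^ 2 * Real.exp (-normSq (e.curve t)) = 0 := by
    have := this.symm; simpa [hn] using this
  simpa using h0

theorem firstIntegral_nonneg (t : ℝ) : 0 ≤ e.firstIntegral t := by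
  unfold firstIntegral; rw [normSq_eq (deriv e.curve t)]; positivity

theorem firstIntegral_le {t : ℝ} (ht : t ∈ e.kind.dom) :
    e.firstIntegral t ≤ ‖e.curve t‖ ^ 2 * Real.exp (-‖e.curve t‖ ^ 2) := by
  have hn := normSq_pos (e.regular t ht)
  rw [firstIntegral, div_le_iff₀ hn, ← normSq_eq]
  have : e.angMom t ^ 2 ≤ normSq (e.curve t) * normSq (deriv e.curve t) := by
    simp only [angMom, cross, normSq]
    nlinarith [sq_nonneg (e.curve t 0 * deriv e.curve t 0 + e.curve t 1 * deriv e.curve t 1)]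
  nlinarith [Real.exp_pos (-normSq (e.curve t))]

/-- A non-compact shrinking curve is radial, since the first integral tends to `0` at infinity. -/
theorem IsShrinking.angMom_eq_zero_of_unbounded (he : e.IsShrinking)
    (hk : e.kind = EdgeKind.ray ∨ e.kind = EdgeKind.line) {t : ℝ} (ht : t ∈ e.kind.dom) :
    e.angMom t = 0 := by
  have hdom : ∀ᶠ s in atTop, s ∈ e.kind.dom := by
    filter_upwards [eventually_ge_atTop 0] with s hs
    rcases hk with hk | hk <;> rw [hk] <;> simp [EdgeKind.dom, hs]
  have h1 : Tendsto (fun s => ‖e.curve s‖ ^ 2 * Real.exp (-‖e.curve s‖ ^ 2)) atTop (𝓝 0) := by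
    have hx := (Real.tendsto_pow_mul_exp_neg_atTop_nhds_zero 1).comp
      ((tendsto_pow_atTop two_ne_zero).comp (e.proper_atTop hk))
    simpa [Function.comp_def] using hx
  have h2 : e.firstIntegral t ≤ 0 := by
    refine ge_of_tendsto h1 (hdom.mono fun s hs => ?_)
    rw [he.firstIntegral_eq ht hs]
    exact firstIntegral_le hs
  have h3 := le_antisymm h2 (firstIntegral_nonneg t)
  have hn := (normSq_pos (e.regular t ht)).ne'
  have : e.angMom t ^ 2 * Real.exp (-normSq (e.curve t)) = 0 := by
    simpa [firstIntegral, hn] using h3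
  simpa using this

/-- A radial shrinking curve is contained in the line through the origin spanned by any of its
tangent vectors. -/
theorem IsShrinking.cross_deriv_curve (he : e.IsShrinking)
    (h0 : ∀ t ∈ e.kind.dom, e.angMom t = 0) {s t : ℝ} (hs : s ∈ e.kind.dom)
    (ht : t ∈ e.kind.dom) : cross (deriv e.curve s) (e.curve t) = 0 := by
  set v := deriv e.curve s
  have h1 : ∀ t ∈ e.kind.dom, cross v (deriv e.curve t) = 0 := by
    intro t ht
    have hn := (normSq_pos (e.regular t ht)).ne'
    have : cross v (deriv e.curve s) ^ 2 / normSq (deriv e.curve s) =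
        cross v (deriv e.curve t) ^ 2 / normSq (deriv e.curve t) := by
      refine eq_of_hasDerivAt_zero (f := fun t => cross v (deriv e.curve t) ^ 2 /
        normSq (deriv e.curve t)) e.kind.ordConnected_dom (fun t ht => ?_) hs ht
      have hn := (normSq_pos (e.regular t ht)).ne'
      have h1 := hasDerivAt_cross (hasDerivAt_const t v) (e.hasDerivAt_deriv t)
      refine ((h1.pow 2).div (hasDerivAt_normSq (e.hasDerivAt_deriv t)) hn).congr_deriv ?_
      rw [div_eq_zero_iff]; left
      have key := he.cross_deriv ht
      rw [h0 t ht, mul_zero] at key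
      simp only [cross, normSq, inner_eq, Pi.pow_apply, PiLp.zero_apply] at key ⊢
      linear_combination 2 * (v 0 * deriv e.curve t 1 - v 1 * deriv e.curve t 0) *
        (v 0 * deriv e.curve t 0 + v 1 * deriv e.curve t 1) * key
    rw [cross_self] at this
    have := this.symm
    simpa [hn] using this
  have h2 : cross v (e.curve t) = cross v (e.curve s) := by
    refine eq_of_hasDerivAt_zero (f := fun t => cross v (e.curve t)) e.kind.ordConnected_dom
      (fun t ht => ?_) ht hs
    have h := hasDerivAt_cross (hasDerivAt_const t v) (e.hasDerivAt_curve t)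
    rw [h1 t ht] at h
    simpa [cross] using h
  rw [h2, cross_swap, neg_eq_zero]
  exact h0 s hs

end Edge

/-! ### Topology of the network -/

/-- The parameters of the points of a curve other than its endpoints. For a closed curve these
are all real numbers, by periodicity. -/
def EdgeKind.inner : EdgeKind → Set ℝ
  | .arc => Ioo 0 1
  | .ray => Ioi 0
  | .line => univ
  | .loop => univ

theorem EdgeKind.isOpen_inner (k : EdgeKind) : IsOpen k.inner := by
  cases k
  exacts [isOpen_Ioo, isOpen_Ioi, isOpen_univ, isOpen_univ]

theorem EdgeKind.isPreconnected_inner (k : EdgeKind) : IsPreconnected k.inner := by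
  cases k
  exacts [isPreconnected_Ioo, isPreconnected_Ioi, isPreconnected_univ, isPreconnected_univ]

theorem EdgeKind.mem_inner_or_mem_endpoints {k : EdgeKind} {t : ℝ} (ht : t ∈ k.dom) :
    t ∈ k.inner ∨ t ∈ k.endpoints := by
  cases k
  · rcases eq_or_lt_of_le ht.1 with h | h
    · exact Or.inr (Or.inl h.symm)
    · rcases eq_or_lt_of_le ht.2 with h' | h'
      · exact Or.inr (Or.inr h')
      · exact Or.inl ⟨h, h'⟩
  · rcases eq_or_lt_of_le (show (0 : ℝ) ≤ t from ht) with h | h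
    · exact Or.inr h.symm
    · exact Or.inl h
  · exact Or.inl trivial
  · exact Or.inl trivial

namespace Edge

variable {e : Edge}

theorem image_dom_of_loop (h : e.kind = EdgeKind.loop) :
    e.curve '' e.kind.dom = range e.curve := by
  refine (image_subset_range _ _).antisymm ?_
  rintro _ ⟨t, rfl⟩
  obtain ⟨s, hs, hst⟩ := (e.periodic h).exists_mem_Ico₀ one_pos t
  exact ⟨s, by rw [h]; exact hs, hst.symm⟩

/-- Every parameter in `inner` has the same curve and velocity as a parameter in the domain which
is not an endpoint. -/
theorem exists_mem_dom {t : ℝ} (ht : t ∈ e.kind.inner) :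
    ∃ s ∈ e.kind.dom, s ∉ e.kind.endpoints ∧ e.curve s = e.curve t ∧
      deriv e.curve s = deriv e.curve t := by
  rcases hk : e.kind with _ | _ | _ | _ <;> rw [hk] at ht
  · refine ⟨t, ⟨ht.1.le, ht.2.le⟩, ?_, rfl, rfl⟩
    rintro (h | h)
    exacts [ht.1.ne' h, ht.2.ne h]
  · have ht' : 0 < t := ht
    exact ⟨t, ht'.le, ht'.ne', rfl, rfl⟩
  · exact ⟨t, trivial, id, rfl, rfl⟩
  · refine ⟨Int.fract t, ⟨Int.fract_nonneg t, Int.fract_lt_one t⟩, id, ?_, ?_⟩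
    · have := (e.periodic hk).sub_int_mul_eq (x := t) ⌊t⌋
      rwa [mul_one] at this
    · have h1 : (fun x => e.curve (x - ⌊t⌋)) = e.curve := by
        funext x
        have := (e.periodic hk).sub_int_mul_eq (x := x) ⌊t⌋
        rwa [mul_one] at this
      have h2 := deriv_comp_sub_const (f := e.curve) (a := (⌊t⌋ : ℝ)) (x := t)
      rw [h1] at h2
      exact h2.symm

theorem image_mem_of_mem_inner {t : ℝ} (ht : t ∈ e.kind.inner) :
    e.curve t ∈ e.curve '' e.kind.dom := by
  obtain ⟨s, hs, -, h, -⟩ := exists_mem_dom ht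
  exact ⟨s, hs, h⟩

variable (e) in
theorem isClosed_image : IsClosed (e.curve '' e.kind.dom) := by
  rcases hk : e.kind with _ | _ | _ | _
  · exact (isCompact_Icc.image e.continuous_curve).isClosed
  · -- the ray is the range of the proper map `t ↦ γ |t|`
    have h1 : e.curve '' EdgeKind.ray.dom = range fun t => e.curve |t| := by
      ext x
      constructor
      · rintro ⟨t, ht, rfl⟩
        exact ⟨t, by simp only [abs_of_nonneg (show (0 : ℝ) ≤ t from ht)]⟩
      · rintro ⟨t, rfl⟩
        exact ⟨|t|, abs_nonneg t, rfl⟩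
    rw [h1]
    refine (isProperMap_iff_tendsto_cocompact.2 ⟨e.continuous_curve.comp continuous_abs,
      ?_⟩).isClosedMap.isClosed_range
    rw [← Metric.cobounded_eq_cocompact, ← Metric.cobounded_eq_cocompact,
      ← tendsto_norm_atTop_iff_cobounded]
    exact (e.proper_atTop (Or.inl hk)).comp tendsto_norm_cobounded_atTop
  · rw [EdgeKind.dom, image_univ]
    refine (isProperMap_iff_tendsto_cocompact.2 ⟨e.continuous_curve, ?_⟩).isClosedMap.isClosed_range
    rw [← Metric.cobounded_eq_cocompact (α := Plane), ← tendsto_norm_atTop_iff_cobounded,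
      cocompact_eq_atBot_atTop, tendsto_sup]
    exact ⟨e.proper_atBot hk, e.proper_atTop (Or.inr hk)⟩
  · have h1 := image_dom_of_loop hk
    rw [hk] at h1
    rw [h1, ← (e.periodic hk).image_Icc one_pos 0]
    exact (isCompact_Icc.image e.continuous_curve).isClosed

/-- Far from the origin a shrinking curve consists of radial half-lines. -/
theorem IsShrinking.exists_cone (he : e.IsShrinking) : ∃ R : ℝ,
    ∀ x ∈ e.curve '' e.kind.dom, ∀ μ : ℝ, 0 < μ → μ ≤ 1 → R ≤ ‖μ • x‖ →
      μ • x ∈ e.curve '' e.kind.dom := by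
  by_cases hk : e.kind = EdgeKind.ray ∨ e.kind = EdgeKind.line
  · have h0dom : (0 : ℝ) ∈ e.kind.dom := by
      rcases hk with hk | hk <;> rw [hk] <;> simp [EdgeKind.dom]
    refine ⟨‖e.curve 0‖, ?_⟩
    rintro _ ⟨t, ht, rfl⟩ μ hμ hμ1 hR
    have hrad : ∀ s ∈ e.kind.dom, e.angMom s = 0 :=
      fun s hs => he.angMom_eq_zero_of_unbounded hk hs
    set v := deriv e.curve 0
    have hv : v ≠ 0 := e.regular 0 h0dom
    have hnv := norm_pos_iff.2 hv
    set r : ℝ → ℝ := fun s => inner ℝ (e.curve s) v / normSq v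
    have hr : ∀ s ∈ e.kind.dom, e.curve s = r s • v := fun s hs =>
      eq_smul_of_cross_eq_zero hv (he.cross_deriv_curve hrad h0dom hs)
    have hrc : Continuous r := by
      have := e.continuous_curve
      fun_prop
    have hle : |r 0| ≤ |μ * r t| := by
      rw [hr t ht, hr 0 h0dom, smul_smul, norm_smul, norm_smul] at hR
      exact le_of_mul_le_mul_right hR hnv
    have hmem : μ * r t ∈ uIcc (r 0) (r t) := by
      rw [abs_mul, abs_of_pos hμ] at hle
      rw [mem_uIcc]
      rcases le_total 0 (r t) with h | h
      · rw [abs_of_nonneg h] at hle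
        exact Or.inl ⟨(le_abs_self _).trans hle, by nlinarith⟩
      · rw [abs_of_nonpos h] at hle
        exact Or.inr ⟨by nlinarith, by linarith [neg_abs_le (r 0)]⟩
    obtain ⟨s, hs, hsr⟩ := intermediate_value_uIcc hrc.continuousOn hmem
    have hsd := e.kind.ordConnected_dom.uIcc_subset h0dom ht hs
    exact ⟨s, hsd, by rw [hr s hsd, hr t ht, smul_smul, hsr]⟩
  · have hb : Bornology.IsBounded (e.curve '' e.kind.dom) := by
      refine (isCompact_Icc.image e.continuous_curve (s := Icc 0 1)).isBounded.subset
        (image_mono ?_)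
      rcases h : e.kind with _ | _ | _ | _
      · exact subset_rfl
      · exact absurd (Or.inl h) hk
      · exact absurd (Or.inr h) hk
      · exact Ico_subset_Icc_self
    obtain ⟨R, hR⟩ := hb.exists_norm_le
    refine ⟨R + 1, fun x hx μ hμ hμ1 h => ?_⟩
    have := hR x hx
    rw [norm_smul, Real.norm_of_nonneg hμ.le] at h
    nlinarith [norm_nonneg x]

end Edge

variable {ι : Type*} {Γ : PlaneNetwork ι}

theorem IsRegularShrinker.isShrinking (hΓ : Γ.IsRegularShrinker) (i : ι) :
    (Γ.edge i).IsShrinking := hΓ.shrinker i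

theorem mem_carrier_of_mem_dom {i : ι} {t : ℝ} (ht : t ∈ (Γ.edge i).kind.dom) :
    (Γ.edge i).curve t ∈ Γ.carrier := mem_iUnion.2 ⟨i, t, ht, rfl⟩

theorem mem_carrier_of_mem_inner {i : ι} {t : ℝ} (ht : t ∈ (Γ.edge i).kind.inner) :
    (Γ.edge i).curve t ∈ Γ.carrier := mem_iUnion.2 ⟨i, Edge.image_mem_of_mem_inner ht⟩

variable (Γ) in
theorem isClosed_carrier [Finite ι] : IsClosed Γ.carrier :=
  isClosed_iUnion_of_finite fun i => (Γ.edge i).isClosed_image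

variable (Γ) in
theorem dense_compl_carrier [Finite ι] : Dense Γ.carrierᶜ := by
  refine dense_compl_of_dimH_lt_finrank ?_
  have h1 : dimH Γ.carrier ≤ 1 := by
    rw [carrier, dimH_iUnion]
    refine iSup_le fun i => (dimH_mono (image_subset_range _ _)).trans ?_
    simpa using ((Γ.edge i).contDiff.of_le (by norm_num)).dimH_range_le
  refine h1.trans_lt ?_
  rw [finrank_euclideanSpace_fin]
  norm_num

theorem IsRegularShrinker.exists_cone [Finite ι] (hΓ : Γ.IsRegularShrinker) : ∃ R : ℝ,
    ∀ x ∈ Γ.carrier, ∀ μ : ℝ, 0 < μ → μ ≤ 1 → R ≤ ‖μ • x‖ → μ • x ∈ Γ.carrier := by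
  choose R hR using fun i => (hΓ.isShrinking i).exists_cone
  obtain ⟨M, hM⟩ := (Set.finite_range R).bddAbove
  refine ⟨M, fun x hx μ hμ hμ1 h => ?_⟩
  obtain ⟨i, hi⟩ := mem_iUnion.1 hx
  exact mem_iUnion.2 ⟨i, hR i x hi μ hμ hμ1 ((hM (mem_range_self i)).trans h)⟩

theorem finite_ends [Finite ι] : Γ.ends.Finite := by
  refine ((Set.finite_univ (α := ι)).prod (Set.toFinite {(0 : ℝ), 1})).subset ?_
  rintro ⟨i, t⟩ h
  refine ⟨trivial, ?_⟩
  change t ∈ (Γ.edge i).kind.endpoints at h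
  rcases hk : (Γ.edge i).kind with _ | _ | _ | _ <;> rw [hk] at h
  · exact h
  · exact Or.inl h
  · exact h.elim
  · exact h.elim

/-! ### Radial projection onto the network near one of its points -/

/-- A curve issuing from `p` to one side of the radial direction meets all radial lines close to
`p` on that side. The sign of `ω` selects the side. -/
theorem eventually_exists_smul_mem_of_curve {C : Set Plane} {σ : ℝ → Plane} {d p : Plane}
    (hσ : Continuous σ) (hd : HasDerivAt σ d 0) (hC : ∀ᶠ t in 𝓝[≥] 0, σ t ∈ C)
    (hσp : σ 0 = p) (hp : p ≠ 0) {ω : ℝ} (hω : 0 < ω * cross p d) {ε : ℝ} (hε : 0 < ε) :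
    ∀ᶠ q in 𝓝 p, 0 ≤ ω * cross p q → ∃ l : ℝ, |l - 1| < ε ∧ l • q ∈ C := by
  have hn := (normSq_pos hp).ne'
  have hG : Tendsto (fun z : ℝ × Plane => inner ℝ (σ z.1) z.2 / normSq z.2)
      (𝓝 (0, p)) (𝓝 1) := by
    have h1 : ContinuousAt (fun z : ℝ × Plane => inner ℝ (σ z.1) z.2 / normSq z.2) (0, p) := by
      refine ContinuousAt.div ?_ ?_ hn
      · exact Continuous.continuousAt (by fun_prop)
      · exact Continuous.continuousAt (by fun_prop)
    have h2 : inner ℝ (σ 0) p / normSq p = 1 := by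
      rw [hσp, real_inner_self_eq_norm_sq, ← normSq_eq, div_self hn]
    have h3 : Tendsto _ _ (𝓝 (inner ℝ (σ 0) p / normSq p)) := h1
    rwa [h2] at h3
  have hev : ∀ᶠ z : ℝ × Plane in 𝓝 (0, p),
      |inner ℝ (σ z.1) z.2 / normSq z.2 - 1| < ε := by
    have := hG.eventually (Metric.ball_mem_nhds 1 hε)
    simpa [Real.dist_eq] using this
  rw [nhds_prod_eq, eventually_prod_iff] at hev
  obtain ⟨P, hP, Q, hQ, hPQ⟩ := hev
  obtain ⟨δ, hδ, hδP⟩ := mem_nhdsGE_iff_exists_Icc_subset.1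
    ((hP.filter_mono nhdsWithin_le_nhds).and hC)
  have hδ : 0 < δ := hδ
  -- a small time at which the curve is strictly on the chosen side
  have hpos : ∀ᶠ t in 𝓝[>] (0 : ℝ), 0 < ω * cross p (σ t) := by
    have hder : HasDerivAt (fun t => ω * cross p (σ t)) (ω * cross p d) 0 := by
      have := (hasDerivAt_cross (hasDerivAt_const 0 p) hd).const_mul ω
      simpa [cross] using this
    have := (hasDerivAt_iff_tendsto_slope.1 hder).eventually (lt_mem_nhds hω)
    filter_upwards [this.filter_mono (nhdsWithin_mono _ fun x (hx : 0 < x) => hx.ne'),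
      self_mem_nhdsWithin] with t ht ht0
    have ht0 : 0 < t := ht0
    simp only [slope, hσp, cross_self, vsub_eq_sub, sub_zero, mul_zero, smul_eq_mul] at ht
    exact pos_of_mul_pos_right ht (inv_nonneg.2 ht0.le)
  obtain ⟨t₁, ht₁, ht₁δ⟩ := (hpos.and (Ioo_mem_nhdsGT hδ)).exists
  have hq : ∀ᶠ q in 𝓝 p, 0 < ω * cross q (σ t₁) :=
    (Continuous.continuousAt (by fun_prop : Continuous fun q => ω * cross q (σ t₁))).eventually
      (lt_mem_nhds ht₁)
  filter_upwards [hQ, hq, isOpen_ne.mem_nhds hp] with q hqQ hq1 hq0 hside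
  have hmem : (0 : ℝ) ∈ Icc (ω * cross q (σ 0)) (ω * cross q (σ t₁)) := by
    refine ⟨?_, hq1.le⟩
    rw [hσp, cross_swap]; linarith
  have hcont : Continuous fun t => ω * cross q (σ t) := by fun_prop
  obtain ⟨t, ht, ht0⟩ := intermediate_value_Icc ht₁δ.1.le hcont.continuousOn hmem
  have hω0 : ω ≠ 0 := by rintro rfl; simp at hω
  have htδ := hδP ⟨ht.1, ht.2.trans ht₁δ.2.le⟩
  refine ⟨_, hPQ htδ.1 hqQ, ?_⟩
  rw [← eq_smul_of_cross_eq_zero hq0 ((mul_eq_zero.1 ht0).resolve_left hω0)]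
  exact htδ.2

/-- Three vectors at mutual angles `2π/3` cannot all lie on one side of a line through the
origin, since the corresponding unit vectors have sum zero. -/
theorem exists_cross_pos_of_angle {p u v w : Plane} (hp : p ≠ 0)
    (huv : InnerProductGeometry.angle u v = 2 * Real.pi / 3)
    (huw : InnerProductGeometry.angle u w = 2 * Real.pi / 3)
    (hvw : InnerProductGeometry.angle v w = 2 * Real.pi / 3) {ω : ℝ} (hω : ω ≠ 0) :
    0 < ω * cross p u ∨ 0 < ω * cross p v ∨ 0 < ω * cross p w := by
  have hne : ∀ {a b : Plane}, InnerProductGeometry.angle a b = 2 * Real.pi / 3 → a ≠ 0 := by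
    rintro a b h rfl
    rw [InnerProductGeometry.angle_zero_left] at h
    linarith [Real.pi_pos]
  have hcos : Real.cos (2 * Real.pi / 3) = -(1 / 2) := by
    rw [show 2 * Real.pi / 3 = Real.pi - Real.pi / 3 by ring, Real.cos_pi_sub,
      Real.cos_pi_div_three]
  have hu := hne huv
  have hv := hne hvw
  have hw : w ≠ 0 := hne ((InnerProductGeometry.angle_comm w v).trans hvw)
  have key : ∀ {a b : Plane}, InnerProductGeometry.angle a b = 2 * Real.pi / 3 →
      inner ℝ (‖a‖⁻¹ • a) (‖b‖⁻¹ • b) = -(1 / 2 : ℝ) := by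
    intro a b h
    rw [← hcos, ← h, InnerProductGeometry.cos_angle, real_inner_smul_left,
      real_inner_smul_right, div_eq_mul_inv, mul_inv]
    ring
  have hunit : ∀ {a : Plane}, a ≠ 0 → inner ℝ (‖a‖⁻¹ • a) (‖a‖⁻¹ • a) = (1 : ℝ) := by
    intro a ha
    have := norm_ne_zero_iff.2 ha
    rw [real_inner_smul_left, real_inner_smul_right, real_inner_self_eq_norm_sq]
    field_simp
  have hsum : ‖u‖⁻¹ • u + ‖v‖⁻¹ • v + ‖w‖⁻¹ • w = 0 := by
    rw [← inner_self_eq_zero (𝕜 := ℝ)]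
    simp only [inner_add_left, inner_add_right, hunit hu, hunit hv, hunit hw,
      real_inner_comm (‖u‖⁻¹ • u) (‖v‖⁻¹ • v), real_inner_comm (‖u‖⁻¹ • u) (‖w‖⁻¹ • w),
      real_inner_comm (‖v‖⁻¹ • v) (‖w‖⁻¹ • w)]
    linarith [key huv, key huw, key hvw]
  have hc := congrArg (fun x => ω * cross p x) hsum
  simp only [cross_add_right, cross_smul_right, cross_zero_right, mul_zero] at hc
  by_contra! hcon
  obtain ⟨h1, h2, h3⟩ := hcon
  have iu := inv_pos.2 (norm_pos_iff.2 hu)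
  have iv := inv_pos.2 (norm_pos_iff.2 hv)
  have iw := inv_pos.2 (norm_pos_iff.2 hw)
  have e1 := mul_nonpos_of_nonneg_of_nonpos iu.le h1
  have e2 := mul_nonpos_of_nonneg_of_nonpos iv.le h2
  have e3 := mul_nonpos_of_nonneg_of_nonpos iw.le h3
  have z1 : cross p u = 0 := by
    have : ‖u‖⁻¹ * (ω * cross p u) = 0 := by linarith
    simpa [iu.ne', hω] using this
  have z2 : cross p v = 0 := by
    have : ‖v‖⁻¹ * (ω * cross p v) = 0 := by linarith
    simpa [iv.ne', hω] using this
  -- if both `u` and `v` are parallel to `p`, then the angle between them is not `2π/3`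
  have hu' := eq_smul_of_cross_eq_zero hp z1
  have hv' := eq_smul_of_cross_eq_zero hp z2
  have hcr : cross (‖u‖⁻¹ • u) (‖v‖⁻¹ • v) = 0 := by
    rw [cross_smul_left, cross_smul_right, hu', cross_smul_left, hv', cross_smul_right,
      cross_self]
    ring
  have hlag : ∀ a b : Plane, cross a b ^ 2 + inner ℝ a b ^ 2 = inner ℝ a a * inner ℝ b b := by
    intro a b
    simp only [cross, inner_eq]; ring
  have := hlag (‖u‖⁻¹ • u) (‖v‖⁻¹ • v)
  rw [hcr, key huv, hunit hu, hunit hv] at this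
  norm_num at this

/-- At every vertex edges leave to both sides of the radial direction. -/
theorem IsRegular.exists_end_cross_pos (hΓ : Γ.IsRegular) {e : ι × ℝ} (he : e ∈ Γ.ends)
    (hp : Γ.endPoint e ≠ 0) {ω : ℝ} (hω : ω ≠ 0) :
    ∃ f ∈ Γ.ends, Γ.endPoint f = Γ.endPoint e ∧
      0 < ω * cross (Γ.endPoint e) (Γ.endDirection f) := by
  obtain ⟨x, y, z, hxy, hxz, hyz, hS⟩ := Set.ncard_eq_three.1 (hΓ.degree e he)
  have hx : x ∈ {f ∈ Γ.ends | Γ.endPoint f = Γ.endPoint e} := by rw [hS]; simp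
  have hy : y ∈ {f ∈ Γ.ends | Γ.endPoint f = Γ.endPoint e} := by rw [hS]; simp
  have hz : z ∈ {f ∈ Γ.ends | Γ.endPoint f = Γ.endPoint e} := by rw [hS]; simp
  rcases exists_cross_pos_of_angle hp
    (hΓ.angle x hx.1 y hy.1 hxy (hx.2.trans hy.2.symm))
    (hΓ.angle x hx.1 z hz.1 hxz (hx.2.trans hz.2.symm))
    (hΓ.angle y hy.1 z hz.1 hyz (hy.2.trans hz.2.symm)) hω with h | h | h
  exacts [⟨x, hx.1, hx.2, h⟩, ⟨y, hy.1, hy.2, h⟩, ⟨z, hz.1, hz.2, h⟩]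

/-- A radial edge continues below each of its points other than its endpoints. -/
theorem not_eventually_below_of_angMom_eq_zero (hΓ : Γ.IsRegularShrinker) {i : ι} {t : ℝ}
    (ht : t ∈ (Γ.edge i).kind.inner) (hp : (Γ.edge i).curve t ≠ 0)
    (h0 : (Γ.edge i).angMom t = 0) :
    ¬ ∀ᶠ s in 𝓝[<] (1 : ℝ), s • (Γ.edge i).curve t ∉ Γ.carrier := by
  intro hev
  set γ := (Γ.edge i).curve with hγ
  obtain ⟨t', ht', -, hc, hd⟩ := Edge.exists_mem_dom ht
  have hv : deriv γ t ≠ 0 := by rw [hγ, ← hd]; exact (Γ.edge i).regular t' ht'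
  have h0' : (Γ.edge i).angMom t' = 0 := by rwa [Edge.angMom, hc, hd]
  have hrad : ∀ s ∈ (Γ.edge i).kind.inner, cross (γ t) (γ s) = 0 := by
    intro s hs
    obtain ⟨s', hs', -, hcs, -⟩ := Edge.exists_mem_dom hs
    have h1 := (hΓ.isShrinking i).cross_deriv_curve
      (fun r hr => (hΓ.isShrinking i).angMom_eq_zero ht' hr h0') ht' hs'
    have h2 := (hΓ.isShrinking i).cross_deriv_curve
      (fun r hr => (hΓ.isShrinking i).angMom_eq_zero ht' hr h0') ht' ht'
    rw [hd] at h1 h2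
    rw [hcs] at h1
    rw [hc] at h2
    change cross (deriv γ t) (γ s) = 0 at h1
    change cross (deriv γ t) (γ t) = 0 at h2
    rw [eq_smul_of_cross_eq_zero hv h1, eq_smul_of_cross_eq_zero hv h2, cross_smul_left,
      cross_smul_right, cross_self]
    ring
  have hn := (normSq_pos hp).ne'
  -- the coordinate along the radial line is not locally minimal, since its derivative is not zero
  set c : ℝ → ℝ := fun s => inner ℝ (γ s) (γ t) / normSq (γ t)
  have hder : HasDerivAt c (inner ℝ (deriv γ t) (γ t) / normSq (γ t)) t := by
    have := (((Γ.edge i).hasDerivAt_curve t).inner ℝ (hasDerivAt_const t (γ t))).div_const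
      (normSq (γ t))
    simpa using this
  have hne : inner ℝ (deriv γ t) (γ t) / normSq (γ t) ≠ 0 := by
    intro h
    have h1 : inner ℝ (deriv γ t) (γ t) = 0 := by simpa [hn] using h
    have h2 := eq_smul_of_cross_eq_zero (x := deriv γ t) hp h0
    rw [h1, zero_div, zero_smul] at h2
    exact hv h2
  have hct : c t = 1 := by
    simp only [c]
    rw [real_inner_self_eq_norm_sq, ← normSq_eq, div_self hn]
  have hnot : ∃ᶠ s in 𝓝 t, c s < c t := by
    intro h
    have hmin : IsLocalMin c t := h.mono fun s hs => not_lt.1 hs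
    exact hne (hmin.hasDerivAt_eq_zero hder)
  obtain ⟨a, ha, hIoo⟩ := mem_nhdsLT_iff_exists_Ioo_subset.1 hev
  have ha : a < 1 := ha
  have hlarge : ∀ᶠ s in 𝓝 t, a < c s :=
    hder.continuousAt.eventually (lt_mem_nhds (by rw [hct]; exact ha))
  obtain ⟨s, hs, hsa, hsi⟩ :=
    (hnot.and_eventually (hlarge.and ((Γ.edge i).kind.isOpen_inner.mem_nhds ht))).exists
  rw [hct] at hs
  refine hIoo ⟨hsa, hs⟩ ?_
  rw [← eq_smul_of_cross_eq_zero hp (hrad s hsi)]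
  exact mem_carrier_of_mem_inner hsi

/-- If the network has no points directly below its point `p`, then all radial lines close to `p`
meet the network close to `p`: the network does not lie on one side of the radial line. -/
theorem eventually_exists_smul_mem_carrier (hΓ : Γ.IsRegularShrinker) {p : Plane}
    (hp : p ∈ Γ.carrier) (hp0 : p ≠ 0) (hbelow : ∀ᶠ s in 𝓝[<] (1 : ℝ), s • p ∉ Γ.carrier)
    {ε : ℝ} (hε : 0 < ε) :
    ∀ᶠ q in 𝓝 p, ∃ l : ℝ, |l - 1| < ε ∧ l • q ∈ Γ.carrier := by
  suffices H : ∀ ω : ℝ, ω ≠ 0 →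
      ∀ᶠ q in 𝓝 p, 0 ≤ ω * cross p q → ∃ l : ℝ, |l - 1| < ε ∧ l • q ∈ Γ.carrier by
    filter_upwards [H 1 one_ne_zero, H (-1) (by norm_num)] with q h1 h2
    rcases le_total 0 (cross p q) with h | h
    · exact h1 (by linarith)
    · exact h2 (by linarith)
  intro ω hω
  obtain ⟨i, t, ht, rfl⟩ := mem_iUnion.1 hp
  have hplus : ∀ (j : ι) (a : ℝ), HasDerivAt (fun s => (Γ.edge j).curve (a + s))
      (deriv (Γ.edge j).curve a) 0 := fun j a => by
    have := (Γ.edge j).hasDerivAt_curve (a + 0)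
    simpa using this.comp_const_add a 0
  have hminus : ∀ (j : ι) (a : ℝ), HasDerivAt (fun s => (Γ.edge j).curve (a - s))
      (-deriv (Γ.edge j).curve a) 0 := fun j a => by
    have := (Γ.edge j).hasDerivAt_curve (a - 0)
    simpa using this.comp_const_sub a 0
  have hcplus : ∀ (j : ι) (a : ℝ), Continuous fun s => (Γ.edge j).curve (a + s) := fun j a =>
    (Γ.edge j).continuous_curve.comp (by fun_prop)
  have hcminus : ∀ (j : ι) (a : ℝ), Continuous fun s => (Γ.edge j).curve (a - s) := fun j a =>
    (Γ.edge j).continuous_curve.comp (by fun_prop)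
  rcases EdgeKind.mem_inner_or_mem_endpoints ht with hin | hend
  · have hne : (Γ.edge i).angMom t ≠ 0 := fun h0 =>
      not_eventually_below_of_angMom_eq_zero hΓ hin hp0 h0 hbelow
    rcases lt_or_gt_of_ne (mul_ne_zero hω hne) with h | h
    · refine eventually_exists_smul_mem_of_curve (hcminus i t) (hminus i t) ?_ (by simp) hp0 ?_ hε
      · have : ∀ᶠ s in 𝓝 (0 : ℝ), t - s ∈ (Γ.edge i).kind.inner :=
          (Continuous.continuousAt (by fun_prop : Continuous fun s : ℝ => t - s)).eventually_mem
            ((Γ.edge i).kind.isOpen_inner.mem_nhds (by simpa using hin))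
        exact (this.filter_mono nhdsWithin_le_nhds).mono fun s hs => mem_carrier_of_mem_inner hs
      · rw [← neg_one_smul ℝ, cross_smul_right]
        simp only [Edge.angMom] at h
        linarith
    · refine eventually_exists_smul_mem_of_curve (hcplus i t) (hplus i t) ?_ (by simp) hp0 h hε
      have : ∀ᶠ s in 𝓝 (0 : ℝ), t + s ∈ (Γ.edge i).kind.inner :=
        (Continuous.continuousAt (by fun_prop : Continuous fun s : ℝ => t + s)).eventually_mem
          ((Γ.edge i).kind.isOpen_inner.mem_nhds (by simpa using hin))
      exact (this.filter_mono nhdsWithin_le_nhds).mono fun s hs => mem_carrier_of_mem_inner hs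
  · obtain ⟨⟨j, a⟩, hf, hfp, hpos⟩ :=
      hΓ.toIsRegular.exists_end_cross_pos (e := (i, t)) hend hp0 hω
    change a ∈ (Γ.edge j).kind.endpoints at hf
    change (Γ.edge j).curve a = (Γ.edge i).curve t at hfp
    change 0 < ω * cross ((Γ.edge i).curve t) _ at hpos
    have hunit : ∀ᶠ s in 𝓝[≥] (0 : ℝ), s ∈ Icc (0 : ℝ) 1 := Icc_mem_nhdsGE one_pos
    by_cases ha : a = 0
    · subst ha
      rw [endDirection, if_pos rfl] at hpos
      refine eventually_exists_smul_mem_of_curve (hcplus j 0) (hplus j 0) ?_ (by simpa using hfp)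
        hp0 hpos hε
      filter_upwards [hunit] with s hs
      refine mem_carrier_of_mem_dom ?_
      rcases hk : (Γ.edge j).kind with _ | _ | _ | _ <;> rw [hk] at hf
      · simpa [EdgeKind.dom] using hs
      · simpa [EdgeKind.dom] using hs.1
      · exact hf.elim
      · exact hf.elim
    · have hk : (Γ.edge j).kind = EdgeKind.arc ∧ a = 1 := by
        rcases hk : (Γ.edge j).kind with _ | _ | _ | _ <;> rw [hk] at hf
        · exact ⟨rfl, hf.resolve_left ha⟩
        · exact (ha hf).elim
        · exact hf.elim
        · exact hf.elim
      obtain ⟨hk, rfl⟩ := hk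
      rw [endDirection, if_neg ha] at hpos
      refine eventually_exists_smul_mem_of_curve (hcminus j 1) (hminus j 1) ?_
        (by simpa using hfp) hp0 hpos hε
      filter_upwards [hunit] with s hs
      refine mem_carrier_of_mem_dom ?_
      rw [hk]
      exact ⟨by linarith [hs.2], by linarith [hs.1]⟩

/-! ### Unbounded regions are invariant under dilations -/

theorem isPreconnected_ball_diff_zero (r : ℝ) :
    IsPreconnected (Metric.ball (0 : Plane) r \ {0}) := by
  have hrank : 1 < Module.rank ℝ Plane := by
    rw [← Module.finrank_eq_rank, finrank_euclideanSpace_fin]; norm_num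
  have h := ((isPreconnected_Ioo (a := (0 : ℝ)) (b := r)).prod
    (isPreconnected_sphere hrank (0 : Plane) 1)).image (fun z => z.1 • z.2) (by fun_prop)
  convert h using 1
  ext x
  constructor
  · rintro ⟨hx, hx0⟩
    have hx0 : x ≠ 0 := hx0
    have hn := norm_pos_iff.2 hx0
    refine ⟨(‖x‖, ‖x‖⁻¹ • x), ⟨⟨hn, by simpa using hx⟩, ?_⟩, ?_⟩
    · rw [mem_sphere_zero_iff_norm, norm_smul, norm_inv, norm_norm, inv_mul_cancel₀ hn.ne']
    · simp only [smul_smul, mul_inv_cancel₀ hn.ne', one_smul]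
  · rintro ⟨⟨c, y⟩, ⟨hc, hy⟩, rfl⟩
    have hy : ‖y‖ = 1 := by simpa using hy
    have hc : 0 < c ∧ c < r := hc
    have hn : ‖c • y‖ = c := by rw [norm_smul, hy, mul_one, Real.norm_of_nonneg hc.1.le]
    refine ⟨by rw [mem_ball_zero_iff]; simp only [hn]; exact hc.2, ?_⟩
    rw [mem_singleton_iff, ← norm_eq_zero]
    simp only [hn]
    exact hc.1.ne'

/-- A connected open subset of the plane remains connected when the origin is removed. -/
theorem isPreconnected_diff_zero {U : Set Plane} (hU : IsOpen U) (hc : IsPreconnected U) :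
    IsPreconnected (U \ {0}) := by
  by_cases h0 : (0 : Plane) ∈ U
  swap
  · rwa [sdiff_singleton_eq_self h0]
  obtain ⟨r, hr, hball⟩ := Metric.isOpen_iff.1 hU 0 h0
  have key : ∀ u v : Set Plane, IsOpen u → IsOpen v → (U \ {0}) ∩ (u ∩ v) = ∅ →
      U \ {0} ⊆ u ∪ v → Metric.ball (0 : Plane) r \ {0} ⊆ u → U \ {0} ⊆ u := by
    intro u v hu hv hd hsub hP
    have hv' : IsOpen (v ∩ {0}ᶜ) := hv.inter isOpen_compl_singleton
    have hcov : U ⊆ u ∪ Metric.ball 0 r ∪ v ∩ {0}ᶜ := by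
      intro x hx
      by_cases hx0 : x = 0
      · left; right; rw [hx0]; exact Metric.mem_ball_self hr
      · rcases hsub ⟨hx, hx0⟩ with h | h
        exacts [Or.inl (Or.inl h), Or.inr ⟨h, hx0⟩]
    have hdisj : U ∩ ((u ∪ Metric.ball 0 r) ∩ (v ∩ {0}ᶜ)) = ∅ := by
      rw [eq_empty_iff_forall_notMem]
      rintro x ⟨hx, hxu, hxv, hx0⟩
      have : x ∈ u := hxu.elim id fun h => hP ⟨h, hx0⟩
      have hmem : x ∈ (U \ {0}) ∩ (u ∩ v) := ⟨⟨hx, hx0⟩, this, hxv⟩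
      rw [hd] at hmem
      exact hmem
    rcases isPreconnected_iff_subset_of_disjoint.1 hc _ _ (hu.union Metric.isOpen_ball) hv'
      hcov hdisj with h | h
    · rintro x ⟨hx, hx0⟩
      rcases h hx with h | h
      exacts [h, hP ⟨h, hx0⟩]
    · exact absurd rfl (h h0).2
  rw [isPreconnected_iff_subset_of_disjoint]
  intro u v hu hv hsub hd
  have hPsub : Metric.ball (0 : Plane) r \ {0} ⊆ U \ {0} := sdiff_subset_sdiff_left hball
  rcases isPreconnected_iff_subset_of_disjoint.1 (isPreconnected_ball_diff_zero r) u v hu hv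
    (hPsub.trans hsub) (subset_empty_iff.1 (hd ▸ inter_subset_inter_left _ hPsub)) with h | h
  · exact Or.inl (key u v hu hv hd hsub h)
  · exact Or.inr (key v u hv hu (by rwa [inter_comm v u]) (by rwa [union_comm v u]) h)

theorem smul_mem_region {y : Plane} {l : ℝ} (hl : 1 ≤ l)
    (h : ∀ m : ℝ, 1 ≤ m → m ≤ l → m • y ∉ Γ.carrier) :
    l • y ∈ connectedComponentIn Γ.carrierᶜ y := by
  have h1 : IsPreconnected ((fun m : ℝ => m • y) '' Icc 1 l) :=
    isPreconnected_Icc.image _ (by fun_prop)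
  refine h1.subset_connectedComponentIn ⟨1, ⟨le_rfl, hl⟩, one_smul ℝ y⟩ ?_
    ⟨l, ⟨hl, le_rfl⟩, rfl⟩
  rintro _ ⟨m, hm, rfl⟩
  exact h m hm.1 hm.2

/-- The first point of the network on the radial half-line above a point. -/
theorem exists_first_hit [Finite ι] {y : Plane} (hy : y ∉ Γ.carrier)
    (h : ∃ l : ℝ, 1 ≤ l ∧ l • y ∈ Γ.carrier) :
    ∃ l : ℝ, 1 < l ∧ l • y ∈ Γ.carrier ∧ ∀ m : ℝ, 1 ≤ m → m < l → m • y ∉ Γ.carrier := by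
  set S : Set ℝ := {l | 1 ≤ l ∧ l • y ∈ Γ.carrier}
  have hS : IsClosed S := isClosed_Ici.inter
    (Γ.isClosed_carrier.preimage (by fun_prop : Continuous fun l : ℝ => l • y))
  have hb : BddBelow S := ⟨1, fun l hl => hl.1⟩
  have hmem := hS.csInf_mem h hb
  refine ⟨sInf S, lt_of_le_of_ne hmem.1 fun h1 => hy ?_, hmem.2, fun m hm hml hmc => ?_⟩
  · have := hmem.2
    rwa [← h1, one_smul] at this
  · exact absurd (csInf_le hb ⟨hm, hmc⟩) (not_le.2 hml)

theorem eventually_below_of_first_hit {y : Plane} {l : ℝ} (hl : 1 < l) {P : Plane → Prop}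
    (h : ∀ m : ℝ, 1 ≤ m → m < l → P (m • y)) : ∀ᶠ s in 𝓝[<] (1 : ℝ), P (s • l • y) := by
  have hl0 : 0 < l := one_pos.trans hl
  filter_upwards [Ioo_mem_nhdsLT (inv_lt_one_of_one_lt₀ hl)] with s hs
  rw [smul_smul]
  refine h _ ?_ (by nlinarith [hs.2])
  have := mul_le_mul_of_nonneg_right hs.1.le hl0.le
  rwa [inv_mul_cancel₀ hl0.ne'] at this

/-- Meeting the network further out on the radial half-line is an open condition. -/
theorem eventually_exists_hit [Finite ι] (hΓ : Γ.IsRegularShrinker) {y : Plane}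
    (hy : y ∉ Γ.carrier) (hy0 : y ≠ 0) (h : ∃ l : ℝ, 1 ≤ l ∧ l • y ∈ Γ.carrier) :
    ∀ᶠ z in 𝓝 y, ∃ l : ℝ, 1 ≤ l ∧ l • z ∈ Γ.carrier := by
  obtain ⟨l, hl, hlc, hfirst⟩ := exists_first_hit hy h
  have hl0 : 0 < l := one_pos.trans hl
  have hε : 0 < 1 - l⁻¹ := sub_pos.2 (inv_lt_one_of_one_lt₀ hl)
  have hcov := eventually_exists_smul_mem_carrier hΓ hlc (smul_ne_zero hl0.ne' hy0)
    (eventually_below_of_first_hit (P := fun x => x ∉ Γ.carrier) hl hfirst) hε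
  have hcont : Tendsto (fun z : Plane => l • z) (𝓝 y) (𝓝 (l • y)) :=
    Continuous.tendsto (by fun_prop) y
  filter_upwards [hcont.eventually hcov] with z ⟨m, hm, hmc⟩
  refine ⟨m * l, ?_, by rwa [← smul_smul]⟩
  have h1 : l⁻¹ ≤ m := by linarith [(abs_lt.1 hm).1]
  have := mul_le_mul_of_nonneg_right h1 hl0.le
  rwa [inv_mul_cancel₀ hl0.ne'] at this

/-- Not meeting the network further out on the radial half-line is an open condition, since the
network is conical at infinity. -/
theorem eventually_forall_not_hit [Finite ι] (hΓ : Γ.IsRegularShrinker) {y : Plane}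
    (hy0 : y ≠ 0) (h : ∀ l : ℝ, 1 ≤ l → l • y ∉ Γ.carrier) :
    ∀ᶠ z in 𝓝 y, ∀ l : ℝ, 1 ≤ l → l • z ∉ Γ.carrier := by
  obtain ⟨R, hR⟩ := hΓ.exists_cone
  have hn := norm_pos_iff.2 hy0
  obtain ⟨L, hL1, hLR⟩ : ∃ L : ℝ, 1 ≤ L ∧ R < ‖L • y‖ := by
    refine ⟨max 1 (|R| / ‖y‖ + 1), le_max_left _ _, ?_⟩
    rw [norm_smul, Real.norm_of_nonneg (zero_le_one.trans (le_max_left _ _))]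
    have h1 := mul_le_mul_of_nonneg_right (le_max_right 1 (|R| / ‖y‖ + 1)) hn.le
    rw [add_mul, div_mul_cancel₀ _ hn.ne', one_mul] at h1
    linarith [le_abs_self R]
  have hcpt : ∀ᶠ z in 𝓝 y, ∀ l ∈ Icc 1 L, l • z ∉ Γ.carrier := by
    refine isCompact_Icc.eventually_forall_of_forall_eventually
      (P := fun (z : Plane) (l : ℝ) => l • z ∉ Γ.carrier) fun l hl => ?_
    have hw : Continuous fun w : Plane × ℝ => w.2 • w.1 := by fun_prop
    exact (Γ.isClosed_carrier.isOpen_compl.preimage hw).mem_nhds (h l hl.1)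
  have hfar : ∀ᶠ z in 𝓝 y, R < ‖L • z‖ :=
    (Continuous.continuousAt (by fun_prop : Continuous fun z : Plane => ‖L • z‖)).eventually
      (lt_mem_nhds hLR)
  filter_upwards [hcpt, hfar] with z hz hzR l hl hlc
  rcases le_or_gt l L with hlL | hlL
  · exact hz l ⟨hl, hlL⟩ hlc
  · have hl0 : 0 < l := one_pos.trans_le hl
    have hL0 : 0 < L := one_pos.trans_le hL1
    have heq : (L / l) • l • z = L • z := by rw [smul_smul, div_mul_cancel₀ _ hl0.ne']
    have := hR _ hlc (L / l) (div_pos hL0 hl0) ((div_le_one hl0).2 hlL.le)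
      (by rw [heq]; exact hzR.le)
    rw [heq] at this
    exact hz L ⟨hL1, le_rfl⟩ this

/-- An unbounded region contains the radial half-line above each of its points. -/
theorem smul_mem_of_not_isBounded [Finite ι] (hΓ : Γ.IsRegularShrinker) {y : Plane}
    (hy : y ∉ Γ.carrier) (hU : ¬ Bornology.IsBounded (connectedComponentIn Γ.carrierᶜ y))
    {l : ℝ} (hl : 1 ≤ l) : l • y ∈ connectedComponentIn Γ.carrierᶜ y := by
  rcases eq_or_ne y 0 with rfl | hy0
  · rw [smul_zero]; exact mem_connectedComponentIn hy
  set U := connectedComponentIn Γ.carrierᶜ y with hUdef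
  have hUo : IsOpen U := Γ.isClosed_carrier.isOpen_compl.connectedComponentIn
  have hUc : U ⊆ Γ.carrierᶜ := connectedComponentIn_subset _ _
  set W := U \ {0}
  have hW : IsPreconnected W := isPreconnected_diff_zero hUo isPreconnected_connectedComponentIn
  have hWo : IsOpen W := hUo.sdiff isClosed_singleton
  set A := {z : Plane | ∀ l : ℝ, 1 ≤ l → l • z ∉ Γ.carrier} with hA
  have hAo : IsOpen (W ∩ A) := by
    rw [isOpen_iff_mem_nhds]
    rintro z ⟨hzW, hzA⟩
    exact inter_mem (hWo.mem_nhds hzW) (eventually_forall_not_hit hΓ hzW.2 hzA)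
  have hBo : IsOpen (W ∩ Aᶜ) := by
    rw [isOpen_iff_mem_nhds]
    rintro z ⟨hzW, hzA⟩
    simp only [hA, mem_compl_iff, mem_ofPred_eq, not_forall, not_not, exists_prop] at hzA
    refine inter_mem (hWo.mem_nhds hzW) ?_
    filter_upwards [eventually_exists_hit hΓ (hUc hzW.1) hzW.2 hzA] with x ⟨m, hm, hmc⟩ hxA
    exact hxA m hm hmc
  have hne : (W ∩ (W ∩ A)).Nonempty := by
    obtain ⟨R, hR⟩ := hΓ.exists_cone
    obtain ⟨z, hzU, hz⟩ : ∃ z ∈ U, max R 0 < ‖z‖ := by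
      by_contra! hcon
      exact hU (isBounded_iff_forall_norm_le.2 ⟨_, hcon⟩)
    have hzW : z ∈ W := ⟨hzU, norm_pos_iff.1 ((le_max_right _ _).trans_lt hz)⟩
    refine ⟨z, hzW, hzW, fun m hm hmc => hUc hzU ?_⟩
    have hm0 : 0 < m := one_pos.trans_le hm
    have heq : m⁻¹ • m • z = z := inv_smul_smul₀ hm0.ne' z
    have := hR _ hmc m⁻¹ (inv_pos.2 hm0) (inv_le_one_of_one_le₀ hm)
      (by rw [heq]; exact ((le_max_left _ _).trans_lt hz).le)
    rwa [heq] at this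
  have hsub : W ⊆ W ∩ A := by
    refine hW.subset_left_of_subset_union hAo hBo ?_ ?_ hne
    · exact Set.disjoint_left.2 fun x hx hx' => hx'.2 hx.2
    · intro x hx
      by_cases hxA : x ∈ A
      exacts [Or.inl ⟨hx, hxA⟩, Or.inr ⟨hx, hxA⟩]
  have hyA : y ∈ A := (hsub ⟨mem_connectedComponentIn hy, hy0⟩).2
  exact smul_mem_region hl fun m hm _ => hyA m hm

/-! ### Finiteness of the set of closed regions -/

/-- Near a point which is not a vertex, on an arc or a closed curve, the network consists of a
short piece of that curve only. -/
theorem exists_isClosed_isolating [Finite ι] {i : ι}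
    (hk : (Γ.edge i).kind = EdgeKind.arc ∨ (Γ.edge i).kind = EdgeKind.loop) {t₀ : ℝ}
    (ht₀ : t₀ ∈ (Γ.edge i).kind.inner) {η : ℝ} (hη : 0 < η) :
    ∃ C : Set Plane, IsClosed C ∧ (Γ.edge i).curve t₀ ∉ C ∧
      Γ.carrier ⊆ C ∪ (Γ.edge i).curve '' Metric.ball t₀ η := by
  obtain ⟨s₀, hs₀, hs₀e, hs₀c, -⟩ := Edge.exists_mem_dom ht₀
  set γ := (Γ.edge i).curve
  have hγ : Continuous γ := (Γ.edge i).continuous_curve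
  have hemb : ∀ j, ∀ s ∈ (Γ.edge j).kind.dom, (Γ.edge j).curve s = γ t₀ → i = j ∧ s₀ = s := by
    intro j s hs h
    rcases Γ.embedded i j s₀ hs₀ s hs (hs₀c.trans h.symm) with h | h
    exacts [h, absurd h.1 hs₀e]
  obtain ⟨C, hC, hCt, hCsub⟩ : ∃ C : Set Plane, IsClosed C ∧ γ t₀ ∉ C ∧
      γ '' (Γ.edge i).kind.dom ⊆ C ∪ γ '' Metric.ball t₀ η := by
    rcases hk with hk | hk
    · refine ⟨γ '' (Icc 0 1 \ Metric.ball t₀ η),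
        ((isCompact_Icc.diff Metric.isOpen_ball).image hγ).isClosed, ?_, ?_⟩
      · rintro ⟨s, ⟨hs, hsb⟩, hst⟩
        have h1 := (hemb i s (by rw [hk]; exact hs) hst).2
        rw [hk] at ht₀
        have h2 := (hemb i t₀ (by rw [hk]; exact Ioo_subset_Icc_self ht₀) rfl).2
        rw [← h1, h2] at hsb
        exact hsb (Metric.mem_ball_self hη)
      · rw [hk, ← image_union]
        refine image_mono fun s hs => ?_
        by_cases h : s ∈ Metric.ball t₀ η
        exacts [Or.inr h, Or.inl ⟨hs, h⟩]
    · have hper := (Γ.edge i).periodic hk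
      refine ⟨γ '' Icc (t₀ + η) (t₀ + 1 - η), (isCompact_Icc.image hγ).isClosed, ?_, ?_⟩
      · rintro ⟨s, hs, hst⟩
        have hfr : ∀ x, γ (Int.fract x) = γ x := fun x => by
          have := hper.sub_int_mul_eq (x := x) ⌊x⌋
          rwa [mul_one] at this
        have hdom : ∀ x : ℝ, Int.fract x ∈ (Γ.edge i).kind.dom := fun x => by
          rw [hk]; exact ⟨Int.fract_nonneg x, Int.fract_lt_one x⟩
        have h1 := (hemb i _ (hdom s) ((hfr s).trans hst)).2
        have h2 := (hemb i _ (hdom t₀) (hfr t₀)).2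
        obtain ⟨z, hz⟩ := Int.fract_eq_fract.1 (h1.symm.trans h2)
        have hz0 : (0 : ℝ) < z := by linarith [hs.1]
        have hz1 : (z : ℝ) < 1 := by linarith [hs.2]
        have hz0' : 0 < z := by exact_mod_cast hz0
        have hz1' : z < 1 := by exact_mod_cast hz1
        omega
      · rw [Edge.image_dom_of_loop hk]
        rintro _ ⟨t, rfl⟩
        obtain ⟨s, hs, hst⟩ := hper.exists_mem_Ico one_pos t t₀
        rw [hst]
        rcases lt_or_ge s (t₀ + η) with h | h
        · exact Or.inr ⟨s, by rw [Real.ball_eq_Ioo]; exact ⟨by linarith [hs.1], h⟩, rfl⟩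
        rcases le_or_gt s (t₀ + 1 - η) with h' | h'
        · exact Or.inl ⟨s, ⟨h, h'⟩, rfl⟩
        · refine Or.inr ⟨s - 1, ?_, hper.sub_eq s⟩
          rw [Real.ball_eq_Ioo]
          exact ⟨by linarith, by linarith [hs.2]⟩
  refine ⟨C ∪ ⋃ j : {j // j ≠ i}, (Γ.edge j).curve '' (Γ.edge j).kind.dom,
    hC.union (isClosed_iUnion_of_finite fun j => (Γ.edge j).isClosed_image), ?_, ?_⟩
  · rintro (h | h)
    · exact hCt h
    · obtain ⟨⟨j, hj⟩, s, hs, hst⟩ := mem_iUnion.1 h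
      exact hj (hemb j s hs hst).1.symm
  · intro x hx
    obtain ⟨j, hj⟩ := mem_iUnion.1 hx
    by_cases hji : j = i
    · subst hji
      exact (hCsub hj).elim (fun h => Or.inl (Or.inl h)) Or.inr
    · exact Or.inl (Or.inr (mem_iUnion.2 ⟨⟨j, hji⟩, hj⟩))

/-- The network has no points in a strip directly below a short piece of a non-radial edge. -/
theorem exists_strip_below [Finite ι] {i : ι}
    (hk : (Γ.edge i).kind = EdgeKind.arc ∨ (Γ.edge i).kind = EdgeKind.loop) {t₀ : ℝ}
    (ht₀ : t₀ ∈ (Γ.edge i).kind.inner) (h0 : (Γ.edge i).angMom t₀ ≠ 0) :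
    ∃ δ > 0, ∀ t ∈ Metric.ball t₀ δ, ∀ s ∈ Ioo (1 - δ) 1, s • (Γ.edge i).curve t ∉ Γ.carrier := by
  set γ := (Γ.edge i).curve
  have hγ : Continuous γ := (Γ.edge i).continuous_curve
  have hγ' : Continuous (deriv γ) := (Γ.edge i).continuous_deriv
  have hev : ∀ᶠ z : ℝ × ℝ in 𝓝 (t₀, t₀), cross (γ z.1) (deriv γ z.2) ≠ 0 :=
    (Continuous.continuousAt (by fun_prop :
      Continuous fun z : ℝ × ℝ => cross (γ z.1) (deriv γ z.2))).eventually_ne h0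
  obtain ⟨η, hη, hcr⟩ := Metric.eventually_nhds_iff_ball.1 hev
  have hcr : ∀ t ∈ Metric.ball t₀ η, ∀ t' ∈ Metric.ball t₀ η, cross (γ t) (deriv γ t') ≠ 0 :=
    fun t ht t' ht' => hcr (t, t') (by rw [← ball_prod_same]; exact ⟨ht, ht'⟩)
  -- distinct points of a short piece lie on distinct radial lines
  have hinj : ∀ t ∈ Metric.ball t₀ η, ∀ a ∈ Metric.ball t₀ η, ∀ b ∈ Metric.ball t₀ η, a < b →
      cross (γ t) (γ a) ≠ cross (γ t) (γ b) := by
    intro t ht a ha b hb hab heq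
    obtain ⟨c, hc, hc0⟩ := exists_hasDerivAt_eq_zero (f := fun x => cross (γ t) (γ x))
      (f' := fun x => cross (γ t) (deriv γ x)) hab
      (Continuous.continuousOn (by fun_prop)) heq (fun x _ => by
        have := hasDerivAt_cross (hasDerivAt_const x (γ t)) ((Γ.edge i).hasDerivAt_curve x)
        simpa [cross] using this)
    rw [Real.ball_eq_Ioo] at ha hb
    exact hcr t ht c (by rw [Real.ball_eq_Ioo]; exact ⟨ha.1.trans hc.1, hc.2.trans hb.2⟩) hc0
  obtain ⟨C, hC, hCt, hsub⟩ := exists_isClosed_isolating hk ht₀ hη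
  have hevC : ∀ᶠ z : ℝ × ℝ in 𝓝 (t₀, 1), z.2 • γ z.1 ∈ Cᶜ :=
    (Continuous.continuousAt (by fun_prop :
      Continuous fun z : ℝ × ℝ => z.2 • γ z.1)).eventually_mem
      (hC.isOpen_compl.mem_nhds (by simpa using hCt))
  obtain ⟨δ, hδ, hδC⟩ := Metric.eventually_nhds_iff_ball.1 hevC
  refine ⟨min δ η, lt_min hδ hη, fun t ht s hs hmem => ?_⟩
  have htη : t ∈ Metric.ball t₀ η := Metric.ball_subset_ball (min_le_right _ _) ht
  have htδ : t ∈ Metric.ball t₀ δ := Metric.ball_subset_ball (min_le_left _ _) ht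
  have hsδ : s ∈ Metric.ball (1 : ℝ) δ := by
    rw [Real.ball_eq_Ioo]
    exact ⟨by linarith [hs.1, min_le_left δ η], by linarith [hs.2]⟩
  rcases hsub hmem with h | ⟨t', ht', h⟩
  · exact hδC (t, s) (by rw [← ball_prod_same]; exact ⟨htδ, hsδ⟩) h
  · change γ t' = s • γ t at h
    have hcross : cross (γ t) (γ t') = cross (γ t) (γ t) := by
      rw [h, cross_smul_right, cross_self, mul_zero]
    rcases lt_trichotomy t' t with hlt | rfl | hlt
    · exact hinj t htη t' ht' t htη hlt hcross
    · have h1 : (1 - s) • γ t' = 0 := by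
        rw [sub_smul, one_smul, sub_eq_zero]; exact h
      rcases smul_eq_zero.1 h1 with h2 | h2
      · linarith [hs.2]
      · refine hcr t' htη t' htη ?_
        rw [h2]; simp [cross]
    · exact hinj t htη t htη t' ht' hlt hcross.symm

/-- The set `F` contains all points directly below the point of parameter `t` of the edge `i`. -/
def IsBelow (Γ : PlaneNetwork ι) (F : Set Plane) (i : ι) (t : ℝ) : Prop :=
  ∀ᶠ s in 𝓝[<] (1 : ℝ), s • (Γ.edge i).curve t ∈ F

theorem region_eq_of_mem {F : Set Plane} (hF : F ∈ Γ.closedRegions) {x : Plane} (hx : x ∈ F) :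
    F = connectedComponentIn Γ.carrierᶜ x := by
  obtain ⟨-, y, -, rfl⟩ := hF
  exact connectedComponentIn_eq hx

/-- The region directly below a non-radial edge is the same all along the edge. -/
theorem isBelow_iff [Finite ι] (hΓ : Γ.IsRegularShrinker) {F : Set Plane}
    (hF : F ∈ Γ.closedRegions) {i : ι}
    (hk : (Γ.edge i).kind = EdgeKind.arc ∨ (Γ.edge i).kind = EdgeKind.loop)
    {s t : ℝ} (hs : s ∈ (Γ.edge i).kind.inner) (ht : t ∈ (Γ.edge i).kind.inner)
    (h0 : (Γ.edge i).angMom s ≠ 0) : Γ.IsBelow F i s ↔ Γ.IsBelow F i t := by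
  have hne : ∀ r ∈ (Γ.edge i).kind.inner, (Γ.edge i).angMom r ≠ 0 := by
    intro r hr hr0
    obtain ⟨r', hr', -, hc, hd⟩ := Edge.exists_mem_dom hr
    obtain ⟨s', hs', -, hc', hd'⟩ := Edge.exists_mem_dom hs
    have h1 : (Γ.edge i).angMom r' = 0 := by rwa [Edge.angMom, hc, hd]
    have h2 := (hΓ.isShrinking i).angMom_eq_zero hr' hs' h1
    rw [Edge.angMom, hc', hd'] at h2
    exact h0 h2
  refine (Γ.edge i).kind.isPreconnected_inner.induction₂
    (fun a b => Γ.IsBelow F i a ↔ Γ.IsBelow F i b) ?_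
    (fun _ _ _ _ _ _ h h' => h.trans h') (fun _ _ _ _ h => h.symm) hs ht
  intro r hr
  obtain ⟨δ, hδ, hstrip⟩ := exists_strip_below hk hr (hne r hr)
  set P := (fun z : ℝ × ℝ => z.2 • (Γ.edge i).curve z.1) '' (Metric.ball r δ ×ˢ Ioo (1 - δ) 1)
  have hP : IsPreconnected P := by
    refine (((convex_ball r δ).isPreconnected).prod isPreconnected_Ioo).image _ ?_
    have := (Γ.edge i).continuous_curve
    exact Continuous.continuousOn (by fun_prop)
  have hPc : P ⊆ Γ.carrierᶜ := by
    rintro _ ⟨⟨t, s⟩, ⟨ht, hs⟩, rfl⟩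
    exact hstrip t ht s hs
  have hIoo : ∀ᶠ s in 𝓝[<] (1 : ℝ), s ∈ Ioo (1 - δ) 1 := Ioo_mem_nhdsLT (by linarith)
  have key : ∀ a ∈ Metric.ball r δ, Γ.IsBelow F i a ↔ P ⊆ F := by
    intro a ha
    constructor
    · intro h
      obtain ⟨s, hsF, hs⟩ := (h.and hIoo).exists
      rw [region_eq_of_mem hF hsF]
      exact hP.subset_connectedComponentIn ⟨(a, s), ⟨ha, hs⟩, rfl⟩ hPc
    · intro h
      exact hIoo.mono fun s hs => h ⟨(a, s), ⟨ha, hs⟩, rfl⟩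
  filter_upwards [mem_nhdsWithin_of_mem_nhds (Metric.ball_mem_nhds r hδ)] with a ha
  rw [key r (Metric.mem_ball_self hδ), key a ha]

/-- The points on radial lines through vertices are negligible. -/
theorem dense_compl_vertex_lines [Finite ι] :
    Dense (⋃ f : Γ.ends, range fun c : ℝ => c • Γ.endPoint f)ᶜ := by
  have : Finite Γ.ends := finite_ends
  refine dense_compl_of_dimH_lt_finrank ?_
  have h1 : dimH (⋃ f : Γ.ends, range fun c : ℝ => c • Γ.endPoint f) ≤ 1 := by
    rw [dimH_iUnion]
    refine iSup_le fun f => ?_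
    simpa using (show ContDiff ℝ 1 fun c : ℝ => c • Γ.endPoint f by fun_prop).dimH_range_le
  refine h1.trans_lt ?_
  rw [finrank_euclideanSpace_fin]
  norm_num

/-- Every closed region lies directly below some non-radial edge. -/
theorem exists_isBelow [Finite ι] (hΓ : Γ.IsRegularShrinker) {F : Set Plane}
    (hF : F ∈ Γ.closedRegions) : ∃ i, ∃ t ∈ (Γ.edge i).kind.inner,
      ((Γ.edge i).kind = EdgeKind.arc ∨ (Γ.edge i).kind = EdgeKind.loop) ∧
      (Γ.edge i).angMom t ≠ 0 ∧ Γ.IsBelow F i t := by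
  obtain ⟨x, hx, hFx⟩ := hF.2
  have hFo : IsOpen F := by
    rw [hFx]; exact Γ.isClosed_carrier.isOpen_compl.connectedComponentIn
  have hxF : x ∈ F := by rw [hFx]; exact mem_connectedComponentIn hx
  have hFne : (F \ {0}).Nonempty := by
    by_contra hcon
    rw [not_nonempty_iff_eq_empty, sdiff_eq_empty] at hcon
    have h1 : F = {0} := hcon.antisymm (by
      rw [singleton_subset_iff]; rwa [mem_singleton_iff.1 (hcon hxF)] at hxF)
    exact not_isOpen_singleton (0 : Plane) (h1 ▸ hFo)
  obtain ⟨y, ⟨hyF, hy0⟩, hyZ⟩ := (dense_compl_vertex_lines (Γ := Γ)).inter_open_nonempty _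
    (hFo.sdiff isClosed_singleton) hFne
  have hy0 : y ≠ 0 := hy0
  have hFy := region_eq_of_mem hF hyF
  have hyc : y ∉ Γ.carrier := connectedComponentIn_subset _ _ (hFx ▸ hyF)
  have hhit : ∃ l : ℝ, 1 ≤ l ∧ l • y ∈ Γ.carrier := by
    by_contra! hcon
    obtain ⟨R, hR⟩ := isBounded_iff_forall_norm_le.1 hF.1
    have hn := norm_pos_iff.2 hy0
    have hl : 1 ≤ |R| / ‖y‖ + 1 := by
      have : 0 ≤ |R| / ‖y‖ := by positivity
      linarith
    have h1 := hR _ (hFy ▸ smul_mem_region hl fun m hm _ => hcon m hm)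
    rw [norm_smul, Real.norm_of_nonneg (zero_le_one.trans hl), add_mul,
      div_mul_cancel₀ _ hn.ne', one_mul] at h1
    linarith [le_abs_self R]
  obtain ⟨l, hl, hlc, hfirst⟩ := exists_first_hit hyc hhit
  have hl0 : 0 < l := one_pos.trans hl
  obtain ⟨i, t, ht, hp⟩ := mem_iUnion.1 hlc
  have hinner : t ∈ (Γ.edge i).kind.inner := by
    refine (EdgeKind.mem_inner_or_mem_endpoints ht).resolve_right fun he => hyZ ?_
    refine mem_iUnion.2 ⟨⟨(i, t), he⟩, l⁻¹, ?_⟩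
    change l⁻¹ • (Γ.edge i).curve t = y
    rw [hp, inv_smul_smul₀ hl0.ne']
  have hne : (Γ.edge i).angMom t ≠ 0 := fun h0 => by
    refine not_eventually_below_of_angMom_eq_zero hΓ hinner ?_ h0 ?_
    · rw [hp]; exact smul_ne_zero hl0.ne' hy0
    · rw [hp]
      exact eventually_below_of_first_hit (P := fun x => x ∉ Γ.carrier) hl hfirst
  refine ⟨i, t, hinner, ?_, hne, ?_⟩
  · by_contra hcon
    refine hne ((hΓ.isShrinking i).angMom_eq_zero_of_unbounded ?_ ht)
    rcases hk : (Γ.edge i).kind with _ | _ | _ | _ <;> simp [hk] at hcon ⊢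
  · rw [IsBelow, hp]
    refine eventually_below_of_first_hit (P := fun x => x ∈ F) hl fun m hm hml => ?_
    rw [hFy]
    exact smul_mem_region hm fun r hr hrm => hfirst r hr (hrm.trans_lt hml)

theorem finite_closedRegions [Finite ι] (hΓ : Γ.IsRegularShrinker) : Γ.closedRegions.Finite := by
  choose i t ht hk h0 hb using fun F : Γ.closedRegions => exists_isBelow hΓ F.2
  refine Set.finite_coe_iff.1 (Finite.of_injective i fun F F' heq => ?_)
  have h1 : Γ.IsBelow F (i F) (t F') :=
    (isBelow_iff hΓ F.2 (hk F) (ht F) (by rw [heq]; exact ht F') (h0 F)).1 (hb F)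
  have h2 := hb F'
  rw [← heq] at h2
  obtain ⟨s, hs, hs'⟩ := (h1.and h2).exists
  exact Subtype.ext ((region_eq_of_mem F.2 hs).trans (region_eq_of_mem F'.2 hs').symm)

/-! ### Star-shapedness -/

theorem smul_mem_closure_closedRegions [Finite ι] (hΓ : Γ.IsRegularShrinker) {z : Plane}
    (hz : z ∈ ⋃ F ∈ Γ.closedRegions, F) {μ : ℝ} (hμ : 0 < μ) (hμ1 : μ ≤ 1) :
    μ • z ∈ closure (⋃ F ∈ Γ.closedRegions, F) := by
  obtain ⟨F, hF, hzF⟩ := mem_iUnion₂.1 hz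
  have hFo : IsOpen F := by
    obtain ⟨-, x, -, rfl⟩ := hF
    exact Γ.isClosed_carrier.isOpen_compl.connectedComponentIn
  -- the points of `μ • F` off the network are dense in `μ • F` and lie in closed regions
  rw [mem_closure_iff_nhds]
  intro N hN
  have hN' : N ∩ (fun w : Plane => μ⁻¹ • w) ⁻¹' F ∈ 𝓝 (μ • z) := by
    refine inter_mem hN ((Continuous.continuousAt (by fun_prop)).preimage_mem_nhds
      (hFo.mem_nhds ?_))
    rwa [inv_smul_smul₀ hμ.ne']
  obtain ⟨w, hwc, hwN, hwF⟩ := Γ.dense_compl_carrier.inter_nhds_nonempty hN'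
  refine ⟨w, hwN, mem_iUnion₂.2 ⟨connectedComponentIn Γ.carrierᶜ w, ⟨?_, w, hwc, rfl⟩,
    mem_connectedComponentIn hwc⟩⟩
  by_contra hunb
  have hw := smul_mem_of_not_isBounded hΓ hwc hunb ((one_le_inv₀ hμ).2 hμ1)
  refine hunb ?_
  rw [connectedComponentIn_eq hw, ← region_eq_of_mem hF hwF]
  exact hF.1

end PlaneNetwork

end

theorem mainTheorem5 {ι : Type*} [Finite ι] (Γ : PlaneNetwork ι)
    (hΓ : Γ.IsRegularShrinker) (hF : Γ.closedRegions.Nonempty) :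
    StarConvex ℝ (0 : PlaneNetwork.Plane) (⋃ F ∈ Γ.closedRegions, closure F) ∧
      (0 : PlaneNetwork.Plane) ∈ ⋃ F ∈ Γ.closedRegions, closure F := by
  rw [← (PlaneNetwork.finite_closedRegions hΓ).closure_biUnion]
  set K := ⋃ F ∈ Γ.closedRegions, F
  have hpos : ∀ μ : ℝ, 0 < μ → μ ≤ 1 → ∀ z ∈ closure K, μ • z ∈ closure K := by
    intro μ hμ hμ1 z hz
    have h := map_mem_closure (f := fun w : PlaneNetwork.Plane => μ • w) (t := closure K)
      (by fun_prop) hz fun w hw => PlaneNetwork.smul_mem_closure_closedRegions hΓ hw hμ hμ1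
    rwa [closure_closure] at h
  have hzero : ∀ z ∈ closure K, (0 : PlaneNetwork.Plane) ∈ closure K := by
    intro z hz
    have h1 : Tendsto (fun μ : ℝ => μ • z) (𝓝[>] 0) (𝓝 0) := by
      have : Tendsto (fun μ : ℝ => μ • z) (𝓝 0) (𝓝 ((0 : ℝ) • z)) :=
        Continuous.tendsto (by fun_prop) 0
      rw [zero_smul] at this
      exact this.mono_left nhdsWithin_le_nhds
    refine isClosed_closure.mem_of_tendsto h1 ?_
    filter_upwards [Ioo_mem_nhdsGT (zero_lt_one' ℝ)] with μ hμ
    exact hpos μ hμ.1 hμ.2.le z hz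
  constructor
  · rw [starConvex_zero_iff]
    intro z hz μ hμ hμ1
    rcases hμ.eq_or_lt with rfl | hμ
    · rw [zero_smul]; exact hzero z hz
    · exact hpos μ hμ hμ1 z hz
  · obtain ⟨F, hF⟩ := hF
    obtain ⟨-, x, hx, rfl⟩ := id hF
    exact hzero x (subset_closure (mem_iUnion₂.2 ⟨_, hF, mem_connectedComponentIn hx⟩))
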